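/- All graphs are finite and simple, and $d_v$ denotes the degree of a vertex $v$. For a graph $G$ having no connected component isomorphic to $K_2$, the augmented Sombor index is $$ASO(G)=\sum_{uv\in E(G)}\sqrt{\frac{d_u^2+d_v^2}{d_u+d_v-2}}.$$ The vertex connectivity of a connected graph with at least two vertices is the minimum number of vertices whose removal results in a graph that is disconnected or trivial (i.e. has exactly one vertex). $G\cup H$ denotes the disjoint union of two vertex-disjoint graphs, and $G\vee H$ their join, obtained from $G\cup H$ by adding all edges between $V(G)$ and $V(H)$. Theorem. Let $G$ be a connected graph of order $n\ge 4$ with vertex connectivity $k$. Then $$ASO(G)\le k\sqrt{\frac{(n-1)^2+k^2}{n+k-3}}+\binom{k}{2}\sqrt{n+\frac{1}{n-2}}+k(n-k-1)\sqrt{n-\frac12+\frac{5}{2(2n-5)}}+\binom{n-k-1}{2}\sqrt{n-1+\frac{1}{n-3}}.$$ If $k\le n-2$, equality holds if and only if $G\cong (K_1\cup K_{n-k-1})\vee K_k$; if $k=n-1$, equality holds if and only if $G\cong K_n$. -/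

import Mathlib

open scoped Classical in
/-- The augmented Sombor index: the sum, over the edges `uv` of `G`, of
`√((d(u)² + d(v)²) / (d(u) + d(v) - 2))`. The denominator is positive on every edge
that is not an isolated edge. -/
noncomputable def SimpleGraph.augmentedSombor {V : Type*} [Fintype V] (G : SimpleGraph V) : ℝ :=
  ∑ e ∈ G.edgeFinset,
    Sym2.lift ⟨fun u v : V =>
      √(((G.degree u : ℝ) ^ 2 + (G.degree v : ℝ) ^ 2) / ((G.degree u : ℝ) + (G.degree v : ℝ) - 2)),
      fun u v => by
        simp only [add_comm]⟩ e

/-- The join of two vertex-disjoint graphs: their disjoint union together with all edges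
between the two vertex sets. -/
def SimpleGraph.graphJoin {V W : Type*} (G : SimpleGraph V) (H : SimpleGraph W) :
    SimpleGraph (V ⊕ W) :=
  (G ⊕g H) ⊔ completeBipartiteGraph V W

/-- The vertex connectivity of a finite graph: the minimum number of vertices whose removal
leaves a graph that is disconnected or trivial (that is, has exactly one vertex). -/
noncomputable def SimpleGraph.vertexConnectivity {V : Type*} (G : SimpleGraph V) : ℕ :=
  sInf {m : ℕ | ∃ S : Finset V, S.card = m ∧
    (¬ (G.induce ((S : Set V)ᶜ)).Preconnected ∨ ((S : Set V)ᶜ).ncard = 1)}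

/-- The explicit upper bound for the augmented Sombor index of a connected graph of order `n`
with vertex connectivity `k`. It is meant for `4 ≤ n` and `k ≤ n - 1`. -/
noncomputable def connectivityBound (n k : ℕ) : ℝ :=
  (k : ℝ) * √((((n : ℝ) - 1) ^ 2 + (k : ℝ) ^ 2) / ((n : ℝ) + (k : ℝ) - 3))
    + (k.choose 2 : ℝ) * √((n : ℝ) + 1 / ((n : ℝ) - 2))
    + (k : ℝ) * ((n : ℝ) - (k : ℝ) - 1) * √((n : ℝ) - 1 / 2 + 5 / (2 * (2 * (n : ℝ) - 5)))
    + ((n - k - 1).choose 2 : ℝ) * √((n : ℝ) - 1 + 1 / ((n : ℝ) - 3))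

section

open Finset

/-! Two monotonicity facts carry the proof. `Connected.augmentedSombor_lt_sup_edge`: joining
nonadjacent `u`, `v` strictly increases the index. Each old edge at `u` loses at most `1 / (2
√d_u)`, so the edges at `u` lose at most `√d_u / 2` together, likewise at `v`, and the new edge
outweighs both losses.

A cut `S` of size `k` makes `G` a spanning subgraph of `(K_a ∪ K_b) ∨ K_k`, so only these joins
compete; `cliqueJoinSombor_lt` shows that `a, b ≥ 2` is strictly worse than `1, a + b - 1`. Equality
thus forces `G` to be a join with `a = 1` or `b = 1`. For `k = n - 1`, comparison with the complete
graph suffices. -/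

/-! ### Estimates for the weight of one edge -/

/-- The contribution of an edge with end degrees `x` and `y` to the augmented Sombor index. -/
noncomputable def sombWeight (x y : ℝ) : ℝ := √((x ^ 2 + y ^ 2) / (x + y - 2))

theorem sombWeight_comm (x y : ℝ) : sombWeight x y = sombWeight y x := by
  simp only [sombWeight, add_comm]

theorem sombWeight_nonneg (x y : ℝ) : 0 ≤ sombWeight x y := Real.sqrt_nonneg _

theorem sq_sombWeight {x y : ℝ} (h : 2 < x + y) :
    sombWeight x y ^ 2 = (x ^ 2 + y ^ 2) / (x + y - 2) := by
  rw [sombWeight, Real.sq_sqrt]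
  have : 0 < x + y - 2 := by linarith
  positivity

theorem add_div_two_lt_sq_sombWeight {x y : ℝ} (h : 2 < x + y) :
    (x + y) / 2 + 1 < sombWeight x y ^ 2 := by
  rw [sq_sombWeight h, lt_div_iff₀ (by linarith)]
  nlinarith [sq_nonneg (x - y)]

/-- Raising one end degree of an edge from `d` to `d + 1` costs at most `1 / (2 √d)`. -/
theorem sombWeight_le_succ_add {d y : ℕ} (hd : 1 ≤ d) (hy : 1 ≤ y) (h : 3 ≤ d + y) :
    sombWeight d y ≤ sombWeight (d + 1 : ℕ) y + 1 / (2 * √(d : ℝ)) := by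
  have hd' : (1 : ℝ) ≤ d := by exact_mod_cast hd
  have hy' : (1 : ℝ) ≤ y := by exact_mod_cast hy
  have h' : (3 : ℝ) ≤ d + y := by exact_mod_cast h
  have hs : 0 < √(d : ℝ) := Real.sqrt_pos.2 (by linarith)
  have e1 := sq_sombWeight (x := d) (y := y) (by linarith)
  have e2 := sq_sombWeight (x := (d + 1 : ℕ)) (y := y) (by push_cast; linarith)
  have hp1 : (0 : ℝ) < d + y - 2 := by linarith
  have hp2 : (0 : ℝ) < (d + 1 : ℕ) + y - 2 := by push_cast; linarith
  have n1 := sombWeight_nonneg d y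
  have n2 := sombWeight_nonneg (d + 1 : ℕ) y
  -- Above the diagonal the weight does not decrease from `d` to `d + 1`; it is constant for `y =
  -- 1`, `d = 2`, where both squares are `5`.
  rcases lt_or_ge y d with hyd | hyd
  · have : sombWeight d y ≤ sombWeight (d + 1 : ℕ) y := by
      apply Real.sqrt_le_sqrt
      rw [div_le_div_iff₀ hp1 hp2]
      push_cast
      have hyd' : (y : ℝ) + 1 ≤ d := by exact_mod_cast hyd
      rcases Nat.eq_or_lt_of_le hy with h1 | h1
      · have hy1 : (y : ℝ) = 1 := by exact_mod_cast h1.symm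
        rcases Nat.lt_or_ge d 3 with h3 | h3
        · have hd2 : (d : ℝ) = 2 := by
            have : d = 2 := by omega
            exact_mod_cast this
          rw [hy1, hd2]; norm_num
        · have h3' : (3 : ℝ) ≤ d := by exact_mod_cast h3
          rw [hy1]; nlinarith
      · have h2 : (2 : ℝ) ≤ y := by exact_mod_cast h1
        nlinarith [mul_nonneg (by linarith : (0 : ℝ) ≤ d) (by linarith : (0 : ℝ) ≤ (y : ℝ) - 2)]
    have : 0 ≤ 1 / (2 * √(d : ℝ)) := by positivity
    linarith
  · have hyd' : (d : ℝ) ≤ y := by exact_mod_cast hyd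
    -- With `s` the new weight, the old square is at most `s ^ 2 + 1`, and `√d ≤ s` gives `1 ≤ s /
    -- √d`, the cross term of `(s + 1 / (2 √d)) ^ 2`.
    have key : sombWeight d y ^ 2 ≤ sombWeight (d + 1 : ℕ) y ^ 2 + 1 := by
      rw [e1, e2, div_add_one hp2.ne', div_le_div_iff₀ hp1 hp2]
      push_cast
      rcases Nat.eq_or_lt_of_le hd with h1 | h1
      · have hd1 : (d : ℝ) = 1 := by exact_mod_cast h1.symm
        rw [hd1] at h' ⊢
        nlinarith
      · have h2 : (2 : ℝ) ≤ d := by exact_mod_cast h1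
        nlinarith [mul_nonneg (by linarith : (0 : ℝ) ≤ (y : ℝ) - d)
          (by linarith : (0 : ℝ) ≤ (d : ℝ)), mul_nonneg (by linarith : (0 : ℝ) ≤ (d : ℝ) - 2)
          (by linarith : (0 : ℝ) ≤ (d : ℝ))]
    have hge : √(d : ℝ) ≤ sombWeight (d + 1 : ℕ) y := by
      rw [Real.sqrt_le_left n2]
      have := add_div_two_lt_sq_sombWeight (x := (d + 1 : ℕ)) (y := y) (by push_cast; linarith)
      push_cast at this ⊢
      linarith
    have hsq : (1 : ℝ) ≤ sombWeight (d + 1 : ℕ) y * (1 / √(d : ℝ)) := by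
      rw [mul_one_div, le_div_iff₀ hs]; linarith
    apply abs_le_of_sq_le_sq' _ (by positivity) |>.2
    have : 1 / (2 * √(d : ℝ)) = (1 / √(d : ℝ)) / 2 := by field_simp
    rw [this]
    nlinarith [sq_nonneg (1 / √(d : ℝ))]

theorem sqrt_add_sqrt_lt_sombWeight_succ {a b : ℕ} (h : 1 ≤ a + b) :
    (√(a : ℝ) + √(b : ℝ)) / 2 < sombWeight (a + 1 : ℕ) (b + 1 : ℕ) := by
  have h' : (1 : ℝ) ≤ a + b := by exact_mod_cast h
  have := add_div_two_lt_sq_sombWeight (x := (a + 1 : ℕ)) (y := (b + 1 : ℕ))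
    (by push_cast; linarith)
  push_cast at this
  apply lt_of_pow_lt_pow_left₀ 2 (sombWeight_nonneg _ _)
  push_cast
  have ea := Real.sq_sqrt (Nat.cast_nonneg (α := ℝ) a)
  have eb := Real.sq_sqrt (Nat.cast_nonneg (α := ℝ) b)
  nlinarith [sq_nonneg (√(a : ℝ) - √(b : ℝ))]

/-! ### Adding edges increases the index -/

namespace SimpleGraph

variable {V : Type*}

/-- `sombWeight` of the end degrees of an edge. -/
noncomputable def edgeSombWeight (d : V → ℕ) : Sym2 V → ℝ :=
  Sym2.lift ⟨fun u v => sombWeight (d u) (d v), fun _ _ => sombWeight_comm _ _⟩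

@[simp]
theorem edgeSombWeight_mk (d : V → ℕ) (u v : V) :
    edgeSombWeight d s(u, v) = sombWeight (d u) (d v) := rfl

variable [Fintype V]

open scoped Classical in
theorem augmentedSombor_eq_sum (G : SimpleGraph V) :
    G.augmentedSombor = ∑ e ∈ G.edgeFinset, edgeSombWeight (fun v => G.degree v) e := rfl

open scoped Classical in
theorem neighborFinset_sup_edge_left {G : SimpleGraph V} {u v : V} (hne : u ≠ v) :
    (G ⊔ edge u v).neighborFinset u = insert v (G.neighborFinset u) := by
  ext w
  simp only [mem_neighborFinset, sup_adj, edge_adj, mem_insert]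
  grind

open scoped Classical in
theorem degree_sup_edge_left {G : SimpleGraph V} {u v : V} (hne : u ≠ v) (hn : ¬ G.Adj u v) :
    (G ⊔ edge u v).degree u = G.degree u + 1 := by
  rw [degree, neighborFinset_sup_edge_left hne, card_insert_of_notMem (by simpa using hn), degree]

open scoped Classical in
theorem degree_sup_edge_right {G : SimpleGraph V} {u v : V} (hne : u ≠ v) (hn : ¬ G.Adj u v) :
    (G ⊔ edge u v).degree v = G.degree v + 1 := by
  convert degree_sup_edge_left hne.symm fun h => hn h.symm using 2
  exact congrArg _ (edge_comm u v)

open scoped Classical in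
theorem degree_sup_edge_of_ne {G : SimpleGraph V} {u v w : V} (hu : w ≠ u) (hv : w ≠ v) :
    (G ⊔ edge u v).degree w = G.degree w := by
  rw [degree, degree]
  congr 1
  ext x
  simp only [mem_neighborFinset, sup_adj, edge_adj]
  grind

-- Two adjacent vertices of degree one would form a whole component. This keeps every denominator
-- positive.
open scoped Classical in
theorem Connected.three_le_degree_add_degree {G : SimpleGraph V} (hG : G.Connected)
    (h3 : 3 ≤ Fintype.card V) {x y : V} (h : G.Adj x y) : 3 ≤ G.degree x + G.degree y := by
  by_contra hlt
  have hx : 0 < G.degree x := (G.degree_pos_iff_exists_adj x).2 ⟨y, h⟩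
  have hy : 0 < G.degree y := (G.degree_pos_iff_exists_adj y).2 ⟨x, h.symm⟩
  have hx1 : G.degree x = 1 := by omega
  have hy1 : G.degree y = 1 := by omega
  obtain ⟨x', hx', hxu⟩ := (degree_eq_one_iff_existsUnique_adj).1 hx1
  obtain ⟨y', hy', hyu⟩ := (degree_eq_one_iff_existsUnique_adj).1 hy1
  have hreach : ∀ z, G.Reachable x z → z = x ∨ z = y := by
    rintro z ⟨p⟩
    suffices ∀ a b, G.Walk a b → (a = x ∨ a = y) → (b = x ∨ b = y) from this x z p (.inl rfl)
    intro a b p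
    induction p with
    | nil => exact id
    | cons hab _ ih =>
      rintro (rfl | rfl)
      · exact ih (.inr ((hxu _ hab).trans (hxu _ h).symm))
      · exact ih (.inl ((hyu _ hab).trans (hyu _ h.symm).symm))
  have : (univ : Finset V) ⊆ {x, y} := fun z _ => by
    simpa using hreach z (hG.preconnected x z)
  have h2 := (card_le_card this).trans (card_le_two)
  rw [card_univ] at h2
  omega

open scoped Classical in
theorem Connected.augmentedSombor_lt_sup_edge {G : SimpleGraph V} (hG : G.Connected)
    (h3 : 3 ≤ Fintype.card V) {u v : V} (hne : u ≠ v) (hn : ¬ G.Adj u v) :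
    G.augmentedSombor < (G ⊔ edge u v).augmentedSombor := by
  have : Nontrivial V := Fintype.one_lt_card_iff_nontrivial.1 (by omega)
  set d' : V → ℕ := fun w => (G ⊔ edge u v).degree w with hd'
  have du : d' u = G.degree u + 1 := degree_sup_edge_left hne hn
  have dv : d' v = G.degree v + 1 := degree_sup_edge_right hne hn
  have dw : ∀ w, w ≠ u → w ≠ v → d' w = G.degree w := fun w => degree_sup_edge_of_ne
  have hpos : ∀ w, 1 ≤ G.degree w := fun w => hG.preconnected.degree_pos_of_nontrivial w
  set c : V → ℝ := fun w => 1 / (2 * √(G.degree w : ℝ)) with hc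
  have step : ∀ x y, G.Adj x y → x = u ∨ x = v → y ≠ u → y ≠ v →
      sombWeight (G.degree x) (G.degree y) ≤ sombWeight (d' x) (d' y) + c x := by
    intro x y hxy hx hyu hyv
    have h1 : d' x = G.degree x + 1 := by rcases hx with rfl | rfl <;> assumption
    rw [h1, dw y hyu hyv]
    exact sombWeight_le_succ_add (hpos x) (hpos y) (hG.three_le_degree_add_degree h3 hxy)
  -- As `u` and `v` are nonadjacent, no old edge contains both, so at most one indicator is active.
  have hedge : ∀ e ∈ G.edgeFinset, edgeSombWeight (fun w => G.degree w) e ≤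
      edgeSombWeight d' e + ((if u ∈ e then c u else 0) + (if v ∈ e then c v else 0)) := by
    intro e he
    induction e with | _ x y
    have hxy : G.Adj x y := by simpa using he
    rw [edgeSombWeight_mk, edgeSombWeight_mk]
    by_cases hx : x = u ∨ x = v
    · have hy : y ≠ u ∧ y ≠ v := by
        constructor <;> rintro rfl <;> rcases hx with rfl | rfl
        · exact hxy.ne rfl
        · exact hn hxy.symm
        · exact hn hxy
        · exact hxy.ne rfl
      have := step x y hxy hx hy.1 hy.2
      rcases hx with rfl | rfl <;> simp [hne, hne.symm, hy.1.symm, hy.2.symm] <;> exact this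
    · by_cases hy : y = u ∨ y = v
      · push Not at hx
        have := step y x hxy.symm hy hx.1 hx.2
        rw [sombWeight_comm, sombWeight_comm (d' x)]
        rcases hy with rfl | rfl <;> simp [hne, hne.symm, hx.1.symm, hx.2.symm] <;> exact this
      · push Not at hx hy
        rw [dw x hx.1 hx.2, dw y hy.1 hy.2]
        simp [hx.1.symm, hx.2.symm, hy.1.symm, hy.2.symm]
  have hsum : ∀ w, ∑ e ∈ G.edgeFinset, (if w ∈ e then c w else 0) = √(G.degree w : ℝ) / 2 := by
    intro w
    rw [← sum_filter, sum_const, ← incidenceFinset_eq_filter, card_incidenceFinset_eq_degree,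
      nsmul_eq_mul, hc]
    have h0 : (0 : ℝ) < G.degree w := by exact_mod_cast hpos w
    have hs := Real.sqrt_pos.2 h0
    field_simp
    exact (Real.sq_sqrt h0.le).symm
  have hnew : (√(G.degree u : ℝ) + √(G.degree v : ℝ)) / 2 < sombWeight (d' u) (d' v) := by
    rw [du, dv]
    exact sqrt_add_sqrt_lt_sombWeight_succ (by have := hpos u; omega)
  have htot := sum_le_sum hedge
  rw [sum_add_distrib, sum_add_distrib, hsum, hsum] at htot
  have hfin : (G ⊔ edge u v).augmentedSombor =
      sombWeight (d' u) (d' v) + ∑ e ∈ G.edgeFinset, edgeSombWeight d' e := by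
    have hset : (G ⊔ edge u v).edgeFinset = insert s(u, v) G.edgeFinset := by
      ext e
      simp [edgeSet_edge_of_ne hne, or_comm]
    rw [augmentedSombor_eq_sum]
    convert! sum_insert (a := s(u, v)) (s := G.edgeFinset) (f := edgeSombWeight d')
      (by simpa using hn) using 2
    · convert! hset
    · congr! 3
  rw [hfin, augmentedSombor_eq_sum]
  linarith

theorem Connected.augmentedSombor_lt {G H : SimpleGraph V} (hG : G.Connected)
    (h3 : 3 ≤ Fintype.card V) (h : G < H) : G.augmentedSombor < H.augmentedSombor := by
  induction G using WellFoundedGT.induction with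
  | ind G ih =>
    obtain ⟨u, v, hH, hn⟩ : ∃ u v, H.Adj u v ∧ ¬ G.Adj u v := by
      by_contra! hcon
      exact h.not_ge fun u v => hcon u v
    have hlt := hG.augmentedSombor_lt_sup_edge h3 hH.ne hn
    have hle : G ⊔ edge u v ≤ H := sup_le h.le ((edge_le_iff H).2 (.inr hH))
    rcases hle.eq_or_lt with heq | hlt'
    · rwa [heq] at hlt
    · exact hlt.trans (ih _ (lt_sup_edge (G := G) (s := u) (t := v) hH.ne hn) (hG.mono le_sup_left) hlt')

theorem Connected.augmentedSombor_le {G H : SimpleGraph V} (hG : G.Connected)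
    (h3 : 3 ≤ Fintype.card V) (h : G ≤ H) :
    G.augmentedSombor ≤ H.augmentedSombor ∧ (G.augmentedSombor = H.augmentedSombor ↔ G = H) := by
  rcases h.eq_or_lt with rfl | hlt
  · simp
  · have := hG.augmentedSombor_lt h3 hlt
    exact ⟨this.le, fun h => absurd h this.ne, fun h => absurd h hlt.ne⟩

-- Every edge carries two darts. The double sum over vertices makes isomorphism invariance and the
-- explicit evaluations direct.
open scoped Classical in
theorem two_mul_augmentedSombor (G : SimpleGraph V) :
    2 * G.augmentedSombor =
      ∑ u, ∑ v, if G.Adj u v then sombWeight (G.degree u) (G.degree v) else 0 := by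
  set F := edgeSombWeight (fun v => G.degree v)
  have h1 : ∑ d : G.Dart, F d.edge = 2 * G.augmentedSombor := by
    rw [augmentedSombor_eq_sum, mul_sum,
      ← sum_fiberwise_of_maps_to (s := univ) (t := G.edgeFinset) (g := Dart.edge)
        fun d _ => by simp [d.edge_mem]]
    refine sum_congr rfl fun e he => ?_
    rw [sum_congr rfl fun d hd => by rw [(mem_filter.1 hd).2], sum_const,
      G.dart_edge_fiber_card e (by simpa using he)]
    simp [F]
  rw [← h1, ← Fintype.sum_prod_type', ← sum_filter]
  refine sum_bij' (fun d _ => d.toProd) (fun p hp => ⟨p, (mem_filter.1 hp).2⟩) ?_ ?_ ?_ ?_ ?_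
  · intro d _; simp
  · intros; simp
  · intros; rfl
  · intros; rfl
  · intros; rfl

open scoped Classical in
theorem Iso.augmentedSombor_eq {W : Type*} [Fintype W] {G : SimpleGraph V} {H : SimpleGraph W}
    (e : G ≃g H) : G.augmentedSombor = H.augmentedSombor := by
  have h : 2 * G.augmentedSombor = 2 * H.augmentedSombor := by
    rw [two_mul_augmentedSombor, two_mul_augmentedSombor, ← e.toEquiv.sum_comp]
    refine sum_congr rfl fun u _ => ?_
    rw [← e.toEquiv.sum_comp]
    refine sum_congr rfl fun v _ => ?_
    have hd : ∀ w, H.degree (e w) = G.degree w := fun w => e.degree_eq w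
    simp only [RelIso.coe_fn_toEquiv, e.map_adj_iff, hd]
  linarith

end SimpleGraph

/-! ### Unbalancing the two cliques of a join -/

theorem sombWeight_self_le_self {x y : ℝ} (hx : 2 ≤ x) (hxy : x ≤ y) :
    sombWeight x x ≤ sombWeight y y := by
  apply Real.sqrt_le_sqrt
  rw [div_le_div_iff₀ (by linarith) (by linarith)]
  nlinarith [mul_nonneg (sub_nonneg.2 hxy)
    (by nlinarith : (0 : ℝ) ≤ x * y - x - y)]

theorem sombWeight_le_pred {x N : ℝ} (hx : 2 ≤ x) (hN : 4 ≤ N) (hxN : x ≤ N - 1) :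
    sombWeight x N ≤ sombWeight (N - 1) N := by
  apply Real.sqrt_le_sqrt
  rw [div_le_div_iff₀ (by linarith) (by linarith)]
  nlinarith [mul_nonneg (sub_nonneg.2 hxN)
    (by nlinarith : (0 : ℝ) ≤ (2 * N - 3) * x - (3 * N - 2))]

/-- Bounds the loss on an edge from the cut to the vertex that becomes the singleton clique, whose
degree is only `k`. -/
theorem sq_sombWeight_pred_sub_le {k N : ℝ} (hk : 1 ≤ k) (hN : 4 ≤ N) (hkN : k ≤ N - 1) :
    sombWeight (N - 1) N ^ 2 - sombWeight k N ^ 2 ≤ (N - 1 - k) / 2 := by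
  rw [sq_sombWeight (by linarith), sq_sombWeight (by linarith),
    div_sub_div _ _ (by linarith) (by linarith), div_le_div_iff₀ (by nlinarith) (by norm_num)]
  have e : (((N - 1) ^ 2 + N ^ 2) * (k + N - 2) - (N - 1 + N - 2) * (k ^ 2 + N ^ 2)) =
      (N - 1 - k) * ((2 * N - 3) * k - (3 * N - 2)) := by ring
  rw [e, mul_assoc]
  apply mul_le_mul_of_nonneg_left _ (by linarith)
  nlinarith

/-- The augmented Sombor index of the join of `K_k` with the disjoint union of `K_a` and `K_b`. -/
noncomputable def cliqueJoinSombor (a b k : ℝ) : ℝ :=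
  a * (a - 1) / 2 * sombWeight (a + k - 1) (a + k - 1)
    + b * (b - 1) / 2 * sombWeight (b + k - 1) (b + k - 1)
    + k * (k - 1) / 2 * sombWeight (a + b + k - 1) (a + b + k - 1)
    + k * a * sombWeight (a + k - 1) (a + b + k - 1)
    + k * b * sombWeight (b + k - 1) (a + b + k - 1)

theorem cliqueJoinSombor_lt {a b k : ℝ} (ha : 2 ≤ a) (hb : 2 ≤ b) (hk : 1 ≤ k) :
    cliqueJoinSombor a b k < cliqueJoinSombor 1 (a + b - 1) k := by
  -- `N` is the degree of a vertex of the `K_k` part, one less than the order.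
  obtain ⟨N, hN⟩ : ∃ N, N = a + b + k - 1 := ⟨_, rfl⟩
  have e1 : 1 + (a + b - 1) + k - 1 = N := by rw [hN]; ring
  have e2 : a + b - 1 + k - 1 = N - 1 := by rw [hN]; ring
  have e3 : 1 + k - 1 = k := by ring
  rw [cliqueJoinSombor, cliqueJoinSombor, e1, e2, e3, ← hN]
  have a1 := sombWeight_self_le_self (x := a + k - 1) (y := N - 1) (by linarith) (by linarith)
  have a2 := sombWeight_self_le_self (x := b + k - 1) (y := N - 1) (by linarith) (by linarith)
  have a3 := sombWeight_le_pred (x := a + k - 1) (N := N) (by linarith) (by linarith) (by linarith)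
  have a4 := sombWeight_le_pred (x := b + k - 1) (N := N) (by linarith) (by linarith) (by linarith)
  have a5 := sq_sombWeight_pred_sub_le (k := k) (N := N) hk (by linarith) (by linarith)
  have b1 := add_div_two_lt_sq_sombWeight (x := N - 1) (y := N - 1) (by linarith)
  have b2 := add_div_two_lt_sq_sombWeight (x := N - 1) (y := N) (by linarith)
  have n1 := sombWeight_nonneg k N
  have n2 := sombWeight_nonneg (N - 1) N
  have n3 := sombWeight_nonneg (N - 1) (N - 1)
  set P := sombWeight (N - 1) (N - 1)
  set W := sombWeight (N - 1) N
  set w := sombWeight k N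
  have hs : √N ^ 2 = N := Real.sq_sqrt (by linarith)
  have hs0 : 0 < √N := Real.sqrt_pos.2 (by linarith)
  have hsW : √N ≤ W := Real.sqrt_le_left n2 |>.2 (by linarith)
  have hsP : √N < P := lt_of_pow_lt_pow_left₀ 2 n3 (by linarith)
  -- This is `p + q ≤ 2 p q` for `p = a - 1 ≥ 1`, `q = b - 1 ≥ 1`.
  have hab : (N - 1 - k) / 2 ≤ (a - 1) * (b - 1) := by rw [hN]; nlinarith
  have hab0 : 0 < (a - 1) * (b - 1) := mul_pos (by linarith) (by linarith)
  -- Once `a1`–`a4` raise the degrees on the left to `N - 1`, the right side has `(a - 1) * (b - 1)`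
  -- more edges of weight `P`, and `k` edges of weight `w` instead of `W`.
  have key : k * (W - w) < (a - 1) * (b - 1) * P := by
    rcases le_or_gt W w with h | h
    · have : 0 < (a - 1) * (b - 1) * P := mul_pos hab0 (hs0.trans hsP)
      -- The left side is nonpositive here.
      nlinarith
    · have h1 : (W - w) * √N ≤ (a - 1) * (b - 1) := by nlinarith
      calc k * (W - w) ≤ √N ^ 2 * (W - w) := by
            rw [hs]; exact mul_le_mul_of_nonneg_right (by linarith) (by linarith)
        _ = (W - w) * √N * √N := by ring
        _ ≤ (a - 1) * (b - 1) * √N := mul_le_mul_of_nonneg_right h1 hs0.le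
        _ < _ := mul_lt_mul_of_pos_left hsP hab0
  have c1 := mul_le_mul_of_nonneg_left a1 (by nlinarith : 0 ≤ a * (a - 1) / 2)
  have c2 := mul_le_mul_of_nonneg_left a2 (by nlinarith : 0 ≤ b * (b - 1) / 2)
  have c3 := mul_le_mul_of_nonneg_left a3 (by nlinarith : 0 ≤ k * a)
  have c4 := mul_le_mul_of_nonneg_left a4 (by nlinarith : 0 ≤ k * b)
  linarith

theorem connectivityBound_eq_cliqueJoinSombor {n k : ℕ} (hn : 4 ≤ n) (hk : k + 1 ≤ n) :
    connectivityBound n k = cliqueJoinSombor 1 ((n : ℝ) - k - 1) k := by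
  have hn' : (4 : ℝ) ≤ n := by exact_mod_cast hn
  rw [connectivityBound, cliqueJoinSombor, Nat.cast_choose_two, Nat.cast_choose_two, Nat.sub_sub,
    Nat.cast_sub hk]
  have e1 : sombWeight (1 + k - 1) (1 + (n - k - 1) + k - 1 : ℝ) =
      √((((n : ℝ) - 1) ^ 2 + (k : ℝ) ^ 2) / ((n : ℝ) + (k : ℝ) - 3)) := by
    rw [sombWeight]; congr 1; congr 1 <;> ring
  have e2 : sombWeight (1 + (n - k - 1) + k - 1 : ℝ) (1 + (n - k - 1) + k - 1 : ℝ) =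
      √((n : ℝ) + 1 / ((n : ℝ) - 2)) := by
    rw [sombWeight]; congr 1
    rw [add_div' _ _ _ (by linarith), div_eq_div_iff (by linarith) (by linarith)]; ring
  have e3 : sombWeight (n - k - 1 + k - 1 : ℝ) (1 + (n - k - 1) + k - 1 : ℝ) =
      √((n : ℝ) - 1 / 2 + 5 / (2 * (2 * (n : ℝ) - 5))) := by
    rw [sombWeight]; congr 1
    rw [add_div' _ _ _ (by linarith), div_eq_div_iff (by linarith) (by linarith)]; ring
  have e4 : sombWeight (n - k - 1 + k - 1 : ℝ) (n - k - 1 + k - 1 : ℝ) =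
      √((n : ℝ) - 1 + 1 / ((n : ℝ) - 3)) := by
    rw [sombWeight]; congr 1
    rw [add_div' _ _ _ (by linarith), div_eq_div_iff (by linarith) (by linarith)]; ring
  rw [e1, e2, e3, e4]
  push_cast
  ring

theorem Fintype.sum_ite_ne_const {α : Type*} [Fintype α] [DecidableEq α] (i : α) (c : ℝ) :
    ∑ j, (if i ≠ j then c else 0) = ((Fintype.card α : ℝ) - 1) * c := by
  rw [← sum_filter, sum_const, filter_ne, card_erase_of_mem (mem_univ i), card_univ, nsmul_eq_mul,
    Nat.cast_sub (Fintype.card_pos_iff.2 ⟨i⟩), Nat.cast_one]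

/-! ### Clique joins and vertex cuts -/

namespace SimpleGraph

/-- The join of a complete graph on `K` with the disjoint union of complete graphs on
`A` and `B`. -/
abbrev cliqueJoin (A B K : Type*) : SimpleGraph ((A ⊕ B) ⊕ K) :=
  (completeGraph A ⊕g completeGraph B).graphJoin (completeGraph K)

section cliqueJoin

variable {A B K : Type*}

@[simp]
theorem cliqueJoin_adj_left_left {x y : A} :
    (cliqueJoin A B K).Adj (.inl (.inl x)) (.inl (.inl y)) ↔ x ≠ y := by
  simp [graphJoin]

@[simp]
theorem cliqueJoin_adj_right_right {x y : B} :
    (cliqueJoin A B K).Adj (.inl (.inr x)) (.inl (.inr y)) ↔ x ≠ y := by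
  simp [graphJoin]

@[simp]
theorem cliqueJoin_adj_inr_inr {x y : K} :
    (cliqueJoin A B K).Adj (.inr x) (.inr y) ↔ x ≠ y := by
  simp [graphJoin]

@[simp]
theorem cliqueJoin_not_adj_left_right {x : A} {y : B} :
    ¬ (cliqueJoin A B K).Adj (.inl (.inl x)) (.inl (.inr y)) := by
  simp [graphJoin]

@[simp]
theorem cliqueJoin_not_adj_right_left {x : B} {y : A} :
    ¬ (cliqueJoin A B K).Adj (.inl (.inr x)) (.inl (.inl y)) := by
  simp [graphJoin]

@[simp]
theorem cliqueJoin_adj_inl_inr {x : A ⊕ B} {y : K} :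
    (cliqueJoin A B K).Adj (.inl x) (.inr y) := by
  simp [graphJoin]

@[simp]
theorem cliqueJoin_adj_inr_inl {x : K} {y : A ⊕ B} :
    (cliqueJoin A B K).Adj (.inr x) (.inl y) := by
  simp [graphJoin]

/-- Equivalences of the three parts induce an isomorphism of clique joins. -/
def cliqueJoinCongr {A' B' K' : Type*} (eA : A ≃ A') (eB : B ≃ B') (eK : K ≃ K') :
    cliqueJoin A B K ≃g cliqueJoin A' B' K' where
  toEquiv := (eA.sumCongr eB).sumCongr eK
  map_rel_iff' := by
    rintro ((x | x) | x) ((y | y) | y) <;> simp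

/-- The two disjoint cliques of a clique join may be interchanged. -/
def cliqueJoinSwap (A B K : Type*) : cliqueJoin A B K ≃g cliqueJoin B A K where
  toEquiv := (Equiv.sumComm A B).sumCongr (Equiv.refl K)
  map_rel_iff' := by
    rintro ((x | x) | x) ((y | y) | y) <;> simp

variable [Fintype A] [Fintype B] [Fintype K]

open scoped Classical in
theorem augmentedSombor_cliqueJoin : (cliqueJoin A B K).augmentedSombor =
    cliqueJoinSombor (Fintype.card A) (Fintype.card B) (Fintype.card K) := by
  have hA : ∀ x : A, ((cliqueJoin A B K).degree (.inl (.inl x)) : ℝ) =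
      Fintype.card A + Fintype.card K - 1 := by
    intro x
    rw [degree_eq_sum_if_adj]
    simp only [Fintype.sum_sum_type, cliqueJoin_adj_left_left, cliqueJoin_not_adj_left_right,
      cliqueJoin_adj_inl_inr, Fintype.sum_ite_ne_const]
    simp; ring
  have hB : ∀ x : B, ((cliqueJoin A B K).degree (.inl (.inr x)) : ℝ) =
      Fintype.card B + Fintype.card K - 1 := by
    intro x
    rw [degree_eq_sum_if_adj]
    simp only [Fintype.sum_sum_type, cliqueJoin_adj_right_right, cliqueJoin_not_adj_right_left,
      cliqueJoin_adj_inl_inr, Fintype.sum_ite_ne_const]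
    simp; ring
  have hK : ∀ x : K, ((cliqueJoin A B K).degree (.inr x) : ℝ) =
      Fintype.card A + Fintype.card B + Fintype.card K - 1 := by
    intro x
    rw [degree_eq_sum_if_adj]
    simp only [Fintype.sum_sum_type, cliqueJoin_adj_inr_inr, cliqueJoin_adj_inr_inl,
      Fintype.sum_ite_ne_const]
    simp; ring
  have h := two_mul_augmentedSombor (cliqueJoin A B K)
  simp only [Fintype.sum_sum_type, cliqueJoin_adj_left_left, cliqueJoin_not_adj_left_right,
    cliqueJoin_adj_right_right, cliqueJoin_not_adj_right_left, cliqueJoin_adj_inl_inr,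
    cliqueJoin_adj_inr_inl, cliqueJoin_adj_inr_inr, hA, hB, hK, Fintype.sum_ite_ne_const,
    if_true, if_false, sum_const, card_univ, nsmul_eq_mul, mul_zero, add_zero, zero_add] at h
  rw [sombWeight_comm (_ + _ + _ - 1) (Fintype.card A + Fintype.card K - 1),
    sombWeight_comm (_ + _ + _ - 1) (Fintype.card B + Fintype.card K - 1)] at h
  rw [cliqueJoinSombor]
  linarith

end cliqueJoin

open scoped Classical in
theorem augmentedSombor_top (V : Type*) [Fintype V] :
    (⊤ : SimpleGraph V).augmentedSombor =
      (Fintype.card V : ℝ) * (Fintype.card V - 1) / 2 *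
        sombWeight (Fintype.card V - 1) (Fintype.card V - 1) := by
  obtain ⟨G, hG⟩ : ∃ G : SimpleGraph V, G = ⊤ := ⟨_, rfl⟩
  have hadj : ∀ x y, G.Adj x y ↔ x ≠ y := by simp [hG]
  have hd : ∀ x : V, (G.degree x : ℝ) = Fintype.card V - 1 := by
    intro x
    rw [degree_eq_sum_if_adj]
    simp only [hadj, Fintype.sum_ite_ne_const, mul_one]
  have h := two_mul_augmentedSombor G
  simp only [hadj, hd, Fintype.sum_ite_ne_const, sum_const, card_univ, nsmul_eq_mul] at h
  rw [← hG]
  linarith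

variable {V : Type*} [Fintype V]

/-- A graph that becomes disconnected on removing `S` is, up to isomorphism, a spanning subgraph
of a clique join whose clique of universal vertices is `S`. -/
theorem exists_iso_le_cliqueJoin {G : SimpleGraph V} {S : Finset V}
    (h : ¬ (G.induce ((S : Set V)ᶜ)).Preconnected) :
    ∃ (a b : ℕ) (H : SimpleGraph ((Fin a ⊕ Fin b) ⊕ Fin S.card)), 1 ≤ a ∧ 1 ≤ b ∧
      a + b + S.card = Fintype.card V ∧ Nonempty (G ≃g H) ∧
      H ≤ cliqueJoin (Fin a) (Fin b) (Fin S.card) := by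
  classical
  obtain ⟨x, y, hxy⟩ : ∃ x y, ¬ (G.induce ((S : Set V)ᶜ)).Reachable x y := by
    simpa [Preconnected] using h
  -- One side is the component of `x` in `G - S`, the other everything else outside `S`; no edge
  -- runs between them.
  let p : ((S : Set V)ᶜ : Set V) → Prop := (G.induce ((S : Set V)ᶜ)).Reachable x
  let e₀ : ({u // p u} ⊕ {u // ¬ p u}) ⊕ {v // ¬ v ∈ (S : Set V)ᶜ} ≃ V :=
    ((Equiv.sumCompl p).sumCongr (Equiv.refl _)).trans (Equiv.sumCompl (· ∈ (S : Set V)ᶜ))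
  have hS : Fintype.card {v // ¬ v ∈ (S : Set V)ᶜ} = S.card := by
    rw [Fintype.card_subtype]
    congr 1
    ext; simp
  let e : (Fin (Fintype.card {u // p u}) ⊕ Fin (Fintype.card {u // ¬ p u})) ⊕ Fin S.card ≃ V :=
    (((Fintype.equivFin _).symm.sumCongr (Fintype.equivFin _).symm).sumCongr
      (Fintype.equivFinOfCardEq hS).symm).trans e₀
  refine ⟨Fintype.card {u // p u}, Fintype.card {u // ¬ p u}, G.comap e, ?_, ?_, ?_,
    ⟨(Iso.comap e G).symm⟩, ?_⟩
  · exact Fintype.card_pos_iff.2 ⟨⟨x, Reachable.refl x⟩⟩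
  · exact Fintype.card_pos_iff.2 ⟨⟨y, hxy⟩⟩
  · simpa using Fintype.card_congr e
  · have hcross : ∀ (u : {u // p u}) (v : {u // ¬ p u}), ¬ G.Adj u.1.1 v.1.1 := by
      intro u v huv
      exact v.2 (u.2.trans (Adj.reachable (G := G.induce ((S : Set V)ᶜ)) huv))
    rintro ((u | u) | u) ((v | v) | v) huv
    · simpa using fun h : u = v => huv.ne (by rw [h])
    · exact (hcross _ _ huv).elim
    · simp
    · exact (hcross _ _ huv.symm).elim
    · simpa using fun h : u = v => huv.ne (by rw [h])
    · simp
    · simp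
    · simp
    · simpa using fun h : u = v => huv.ne (by rw [h])

theorem exists_card_eq_vertexConnectivity (G : SimpleGraph V) [Nonempty V] :
    ∃ S : Finset V, S.card = G.vertexConnectivity ∧
      (¬ (G.induce ((S : Set V)ᶜ)).Preconnected ∨ ((S : Set V)ᶜ).ncard = 1) := by
  classical
  refine Nat.sInf_mem (s := {m : ℕ | ∃ S : Finset V, S.card = m ∧
    (¬ (G.induce ((S : Set V)ᶜ)).Preconnected ∨ ((S : Set V)ᶜ).ncard = 1)}) ?_
  obtain ⟨v⟩ := ‹Nonempty V›
  exact ⟨_, univ.erase v, rfl, .inr (Set.ncard_eq_one.2 ⟨v, by ext; simp⟩)⟩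

theorem vertexConnectivity_lt_card (G : SimpleGraph V) [Nonempty V] :
    G.vertexConnectivity < Fintype.card V := by
  classical
  obtain ⟨v⟩ := ‹Nonempty V›
  have : G.vertexConnectivity ≤ (univ.erase v).card :=
    Nat.sInf_le ⟨_, rfl, .inr (Set.ncard_eq_one.2 ⟨v, by ext; simp⟩)⟩
  rw [card_erase_of_mem (mem_univ v), card_univ] at this
  have := Fintype.card_pos_iff.2 ⟨v⟩
  omega

end SimpleGraph

/-! ### The bound and its equality cases -/

theorem cliqueJoinSombor_natCast_le {a b k : ℕ} (ha : 1 ≤ a) (hb : 1 ≤ b) (hk : 1 ≤ k) :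
    cliqueJoinSombor a b k ≤ cliqueJoinSombor 1 (a + b - 1) k ∧
      (cliqueJoinSombor a b k = cliqueJoinSombor 1 (a + b - 1) k → a = 1 ∨ b = 1) := by
  rcases Nat.eq_or_lt_of_le ha with rfl | ha'
  · simp
  rcases Nat.eq_or_lt_of_le hb with rfl | hb'
  · simp only [or_true, implies_true, and_true, cliqueJoinSombor]
    push_cast
    apply le_of_eq
    ring_nf
  · have := cliqueJoinSombor_lt (a := a) (b := b) (k := k) (by exact_mod_cast ha')
      (by exact_mod_cast hb') (by exact_mod_cast hk)
    exact ⟨this.le, fun h => absurd h this.ne⟩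

open SimpleGraph in
theorem connectivityBound_pred_eq_augmentedSombor_top {V : Type*} [Fintype V] {n : ℕ}
    (hn : Fintype.card V = n) (hn4 : 4 ≤ n) :
    connectivityBound n (n - 1) = (⊤ : SimpleGraph V).augmentedSombor := by
  rw [connectivityBound_eq_cliqueJoinSombor hn4 (by omega), augmentedSombor_top, hn,
    cliqueJoinSombor]
  push_cast [Nat.cast_sub (by omega : 1 ≤ n)]
  ring_nf

open SimpleGraph in
theorem connectivityBound_eq_augmentedSombor_cliqueJoin {n k : ℕ} (hn : 4 ≤ n) (hk : k + 1 ≤ n) :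
    connectivityBound n k = (cliqueJoin (Fin 1) (Fin (n - k - 1)) (Fin k)).augmentedSombor := by
  rw [connectivityBound_eq_cliqueJoinSombor hn hk, augmentedSombor_cliqueJoin]
  simp [Nat.sub_sub, Nat.cast_sub hk, sub_sub]

open SimpleGraph in
theorem SimpleGraph.Connected.augmentedSombor_le_connectivityBound {V : Type*} [Fintype V]
    {G : SimpleGraph V} {n k : ℕ} (hn : Fintype.card V = n) (hn4 : 4 ≤ n) (hG : G.Connected)
    (hk : G.vertexConnectivity = k) (hkn : k ≤ n - 2) :
    G.augmentedSombor ≤ connectivityBound n k ∧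
      (G.augmentedSombor = connectivityBound n k →
        Nonempty (G ≃g cliqueJoin (Fin 1) (Fin (n - k - 1)) (Fin k))) := by
  classical
  have := hG.nonempty
  obtain ⟨S, hS, hS'⟩ := G.exists_card_eq_vertexConnectivity
  rw [hk] at hS
  -- A one-vertex complement would give `k = n - 1`.
  have hcut : ¬ (G.induce ((S : Set V)ᶜ)).Preconnected := by
    refine hS'.resolve_right fun h => ?_
    rw [← Finset.coe_compl, Set.ncard_coe_finset, Finset.card_compl] at h
    omega
  have hk1 : 1 ≤ k := by
    by_contra h0
    have hS0 : S = ∅ := Finset.card_eq_zero.1 (by omega)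
    subst hS0
    apply hcut
    rw [Finset.coe_empty, Set.compl_empty]
    exact (induceUnivIso G).preconnected_iff.2 hG.preconnected
  obtain ⟨a, b, H, ha, hb, hcard, ⟨e⟩, hle⟩ := exists_iso_le_cliqueJoin hcut
  subst hS
  have hH : H.Connected := e.connected_iff.1 hG
  obtain ⟨h1, h2⟩ := hH.augmentedSombor_le (by simp; omega) hle
  obtain ⟨h3, h4⟩ := cliqueJoinSombor_natCast_le ha hb hk1
  have hbound : connectivityBound n S.card = cliqueJoinSombor 1 (a + b - 1) S.card := by
    rw [connectivityBound_eq_cliqueJoinSombor hn4 (by omega), ← hn, ← hcard]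
    push_cast
    congr 1
    ring
  rw [augmentedSombor_cliqueJoin] at h1 h2
  simp only [Fintype.card_fin] at h1 h2
  rw [hbound, e.augmentedSombor_eq]
  refine ⟨h1.trans h3, fun heq => ?_⟩
  -- Equality in the bound collapses `h1` and `h3` to equalities: `H` is the full join, and one of
  -- its two cliques is a single vertex.
  obtain rfl := h2.1 (le_antisymm h1 (heq ▸ h3))
  rcases h4 (le_antisymm h3 (heq ▸ h1)) with rfl | rfl
  · exact ⟨e.trans (cliqueJoinCongr (Equiv.refl _) (finCongr (by omega)) (Equiv.refl _))⟩
  · exact ⟨e.trans ((cliqueJoinSwap _ _ _).trans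
      (cliqueJoinCongr (Equiv.refl _) (finCongr (by omega)) (Equiv.refl _)))⟩

end

theorem mainTheorem3 {V : Type*} [Fintype V] (G : SimpleGraph V) (n k : ℕ)
    (hn : Fintype.card V = n) (hn4 : 4 ≤ n) (hG : G.Connected)
    (hk : G.vertexConnectivity = k) :
    G.augmentedSombor ≤ connectivityBound n k ∧
    (k ≤ n - 2 →
      (G.augmentedSombor = connectivityBound n k ↔
        Nonempty (G ≃g
          ((SimpleGraph.completeGraph (Fin 1) ⊕g
              SimpleGraph.completeGraph (Fin (n - k - 1))).graphJoin
            (SimpleGraph.completeGraph (Fin k)))))) ∧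
    (k = n - 1 →
      (G.augmentedSombor = connectivityBound n k ↔
        Nonempty (G ≃g SimpleGraph.completeGraph (Fin n)))) := by
  have := hG.nonempty
  have hlt := G.vertexConnectivity_lt_card
  rw [hk, hn] at hlt
  rcases Nat.lt_or_ge (n - 2) k with h | h
  · obtain rfl : k = n - 1 := by omega
    obtain ⟨h1, h2⟩ := hG.augmentedSombor_le (H := ⊤) (by omega) le_top
    rw [connectivityBound_pred_eq_augmentedSombor_top hn hn4]
    refine ⟨h1, fun h' => by omega, fun _ => ⟨fun heq => ?_, ?_⟩⟩
    · rw [h2.1 heq]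
      exact ⟨SimpleGraph.Iso.completeGraph (Fintype.equivFinOfCardEq hn)⟩
    · rintro ⟨e⟩
      rw [e.augmentedSombor_eq]
      exact (SimpleGraph.Iso.completeGraph (Fintype.equivFinOfCardEq hn)).symm.augmentedSombor_eq
  · obtain ⟨h1, h2⟩ := hG.augmentedSombor_le_connectivityBound hn hn4 hk h
    refine ⟨h1, fun _ => ⟨h2, ?_⟩, fun h' => by omega⟩
    rintro ⟨e⟩
    rw [connectivityBound_eq_augmentedSombor_cliqueJoin hn4 (by omega)]
    exact e.augmentedSombor_eq
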